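/- **Theorem.** Let $0<q<1$ and let $f_0:[0,q]\to\mathbb R$, $f_1:[q,1]\to\mathbb R$ be continuous strictly monotone functions with $0\le f_0(0)<f_0(q)\le 1$ and $0\le f_1(q)<f_1(1)\le 1$; put $\mathcal F=\{f_0,f_1\}$. Let $\ell(m)$ be the number of words $(i_1,\dots,i_m)\in\{0,1\}^m$ such that the domain of $f_{i_m}\circ\cdots\circ f_{i_1}$ has non-empty interior, let $s=\limsup_{m\to\infty}\ell(m)^{1/m}$, and let $\log s$ be the topological entropy of $\mathcal F$. Let $\alpha,\beta\in\{0,1\}^{\mathbb N}$ (indexed from $0$) be the critical itineraries: with $x_0=y_0=q$, $x_{k+1}=f_{\alpha_k}(x_k)$ and $y_{k+1}=f_{\beta_k}(y_k)$, one has $\alpha_k=0$ if $x_k\le q$, $\alpha_k=1$ if $x_k>q$, $\beta_k=0$ if $y_k<q$, and $\beta_k=1$ if $y_k\ge q$ (so $\alpha_0=0$, $\beta_0=1$). Assume $\log s>0$. Then $$s^{-1}=\min\Big\{t\in(0,1):\ \sum_{i=0}^\infty\alpha_i t^i=\sum_{i=0}^\infty\beta_i t^i\Big\}.$$ Moreover,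 there are $p\in(0,1)$ and a system $U=\{U_0,U_1\}$ of affine functions of slope $s$ with domains $[0,p]$ and $[p,1]$ such that $\mathcal F$ in $[0,1]$ is topologically semiconjugate to $U$ in $[0,1]$. That is, $[0,1]$ is invariant under all compositions of the functions of each system and their inverses, and there is a continuous non-decreasing surjection $\varphi:[0,1]\to[0,1]$ with $\varphi(\mathrm{Dom}(f_i))\subset\mathrm{Dom}(U_i)$ and $\varphi\circ f_i=U_i\circ\varphi$ on $\mathrm{Dom}(f_i)$ for $i=0,1$. If in addition $f_0(0)=0$ and $f_1(1)=1$, then this $U$ is given by $U_0(x)=sx$ for $0\le x\le p$ and $U_1(x)=s(x-1)+1$ for $p\le x\le 1$, where $$p=(1-s^{-1})\sum_{i=0}^\infty\alpha_i s^{-i}.$$ -/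

import Mathlib

open Set Filter

/-- A (possibly degenerate) system of `n` continuous strictly monotone functions `f_i : I_i → ℝ`,
where `I_i = [left i, right i]` is a compact interval. Only the values of `map i` on `I_i` matter. -/
structure IntervalSystem (n : ℕ) where
  left : Fin n → ℝ
  right : Fin n → ℝ
  left_le_right : ∀ i, left i ≤ right i
  map : Fin n → ℝ → ℝ
  continuousOn_map : ∀ i, ContinuousOn (map i) (Icc (left i) (right i))
  strict_map : ∀ i, StrictMonoOn (map i) (Icc (left i) (right i)) ∨
    StrictAntiOn (map i) (Icc (left i) (right i))

namespace IntervalSystem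

/-- The domain `I_i` of the `i`-th function. -/
def dom {n : ℕ} (F : IntervalSystem n) (i : Fin n) : Set ℝ := Icc (F.left i) (F.right i)

/-- The graph of the `i`-th function (letter `(i, true)`) or of its inverse (letter `(i, false)`). -/
def letterRel {n : ℕ} (F : IntervalSystem n) : Fin n × Bool → ℝ → ℝ → Prop
  | (i, true), x, y => x ∈ F.dom i ∧ F.map i x = y
  | (i, false), x, y => y ∈ F.dom i ∧ F.map i y = x

/-- The graph of the partial function obtained by composing the letters of a word; the first
letter of the word acts first, and the empty word acts as the identity of `ℝ`. -/
def wordRel {n : ℕ} (F : IntervalSystem n) : List (Fin n × Bool) → ℝ → ℝ → Prop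
  | [], x, y => x = y
  | a :: w, x, y => ∃ z, F.letterRel a x z ∧ F.wordRel w z y

/-- The domain of the composition `f_{i_m} ∘ ⋯ ∘ f_{i_1}` along the word `i_1, …, i_m`. -/
def wordDom {n : ℕ} (F : IntervalSystem n) (w : List (Fin n)) : Set ℝ :=
  {x | ∃ y, F.wordRel (w.map fun i => (i, true)) x y}

/-- `ℓ(m)`: the number of words of length `m` whose composition has a domain with nonempty
interior. -/
noncomputable def wordCount {n : ℕ} (F : IntervalSystem n) (m : ℕ) : ℕ :=
  Nat.card {w : Fin m → Fin n // (interior (F.wordDom (List.ofFn w))).Nonempty}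

/-- The growth number `s = limsup ℓ(m)^{1/m}` (the sequence takes values in `[0, max n 1]`). -/
noncomputable def growthNumber {n : ℕ} (F : IntervalSystem n) : ℝ :=
  limsup (fun m : ℕ => (F.wordCount m : ℝ) ^ (1 / (m : ℝ))) atTop

/-- The topological entropy `log s`, with `log 0 = -∞`. -/
noncomputable def entropy {n : ℕ} (F : IntervalSystem n) : EReal :=
  ENNReal.log (ENNReal.ofReal F.growthNumber)

/-- `K` is invariant: `f_g (K ∩ Dom f_g) ⊆ K` for every element `g` of the free group on the
`n` generators, `f_g` being the composition along the reduced word of `g`. -/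
def IsInvariant {n : ℕ} (F : IntervalSystem n) (K : Set ℝ) : Prop :=
  ∀ g : FreeGroup (Fin n), ∀ x ∈ K, ∀ y, F.wordRel g.toWord x y → y ∈ K

/-- `φ` and `τ` form a topological semiconjugacy from `F` in the invariant set `K` to `U` in the
invariant set `K'`. -/
structure IsSemiconjugacy {n m : ℕ} (F : IntervalSystem n) (K : Set ℝ)
    (U : IntervalSystem m) (K' : Set ℝ) (τ : Fin n → Fin m) (φ : ℝ → ℝ) : Prop where
  invariant_source : F.IsInvariant K
  invariant_target : U.IsInvariant K'
  monotoneOn : MonotoneOn φ K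
  continuousOn : ContinuousOn φ K
  image_eq : φ '' K = K'
  mapsTo_dom : ∀ i, MapsTo φ (K ∩ F.dom i) (K' ∩ U.dom (τ i))
  semiconj : ∀ i, ∀ x ∈ K ∩ F.dom i, φ (F.map i x) = U.map (τ i) (φ x)

/-- Every function of the system is affine with slope `s` on its domain. -/
def IsAffineWithSlope {n : ℕ} (U : IntervalSystem n) (s : ℝ) : Prop :=
  ∀ i, ∃ b : ℝ, ∀ x ∈ U.dom i, U.map i x = s * x + b

/-- The orbit of `q` when the function applied at a point `x` is the one with index `sym x`. -/
def symOrbit (F : IntervalSystem 2) (sym : ℝ → Fin 2) (q : ℝ) : ℕ → ℝ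
  | 0 => q
  | k + 1 => F.map (sym (F.symOrbit sym q k)) (F.symOrbit sym q k)

/-- The critical itinerary `α` of `q`: the symbol is `0` on `[0, q]` and `1` on `(q, 1]`, so that
`α_0 = 0` and every return to `q` is given the symbol `0`. -/
noncomputable def leftItinerary (F : IntervalSystem 2) (q : ℝ) (k : ℕ) : Fin 2 :=
  let sym : ℝ → Fin 2 := fun x => if x ≤ q then 0 else 1
  sym (F.symOrbit sym q k)

/-- The critical itinerary `β` of `q`: the symbol is `0` on `[0, q)` and `1` on `[q, 1]`, so that
`β_0 = 1` and every return to `q` is given the symbol `1`. -/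
noncomputable def rightItinerary (F : IntervalSystem 2) (q : ℝ) (k : ℕ) : Fin 2 :=
  let sym : ℝ → Fin 2 := fun x => if x < q then 0 else 1
  sym (F.symOrbit sym q k)

/-- The power series `∑ a_i t^i` of a sequence of symbols in `{0, 1}`, summed at a real `t`. -/
noncomputable def symbolSeries (a : ℕ → Fin 2) (t : ℝ) : ℝ :=
  ∑' i : ℕ, ((a i : ℕ) : ℝ) * t ^ i

end IntervalSystem

/-!
The system is a Lorenz map: two increasing branches on `[0, q]` and `[q, 1]`. Write `ℓ_m(x, y)` for
the number of laps of the `m`-th iterate on `[x, y]`, so that `ℓ(m) = ℓ_m(0, 1)`. Everything rests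
on a recursion for these numbers: a single branch maps the laps of the `(m + 1)`-st iterate to the
laps of the `m`-th iterate on the image (`lapCount_succ_branch`), and `q` separates laps
(`lapCount_succ_split`). Hence `ℓ_m` is additive in the interval up to an error of one
(`lapCount_add`) and submultiplicative in `m`, so that `ℓ(m) ≥ s ^ m` by Fekete's lemma and
`∑ ℓ(m) t ^ m` converges for `t < 1 / s` and tends to infinity as `t` increases to `1 / s`.

The semiconjugacy, following Milnor and Thurston, is an accumulation point `φ(x)` of
`∑ ℓ_m(0, x) t ^ m / ∑ ℓ_m(0, 1) t ^ m` as `t` increases to `1 / s` (`exists_isConformal`): the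
bounded errors disappear against the divergent denominator, so that
`φ (f_i y) - φ (f_i x) = s (φ y - φ x)` on each branch. A jump of `φ` would grow by the factor `s`
along an orbit, so `φ` is continuous (`conformal_continuousOn`), and it carries the system to affine
functions of slope `s`.

In the affine model the position of a point is an affine function of its itinerary series at `1 / s`
(`conformal_eq_itinerarySeries`). Comparing the two itineraries of `q` shows that `1 / s` is a root
of the equation of the theorem, and gives the formula for `p`. Conversely, if the two critical
series agree at `t < 1 / s`, the itinerary series at `t` have no jumps and vary by `O(t ^ m)` on
every lap of the `m`-th iterate, so in total by `O(ℓ(m) t ^ m)`, which tends to zero. They are then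
all equal to one constant, which is impossible because the two branches start with different
symbols (`inv_growthNumber_le`).
-/

namespace IntervalSystem

/-! ### Lap counts -/

/-- The set contains a nondegenerate compact interval. -/
def HasInterval (S : Set ℝ) : Prop := ∃ a b : ℝ, a < b ∧ Icc a b ⊆ S

theorem HasInterval.mono {S T : Set ℝ} (hS : HasInterval S) (h : S ⊆ T) : HasInterval T := by
  obtain ⟨a, b, hab, hsub⟩ := hS
  exact ⟨a, b, hab, hsub.trans h⟩

theorem hasInterval_iff_interior_nonempty {S : Set ℝ} :
    HasInterval S ↔ (interior S).Nonempty := by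
  constructor
  · rintro ⟨a, b, hab, hsub⟩
    obtain ⟨c, hc⟩ := exists_between hab
    exact ⟨c, interior_mono hsub (by rw [interior_Icc]; exact hc)⟩
  · rintro ⟨x, hx⟩
    obtain ⟨ε, hε, hball⟩ := Metric.isOpen_iff.1 isOpen_interior x hx
    refine ⟨x, x + ε / 2, by linarith, fun y hy => interior_subset (hball ?_)⟩
    rw [Metric.mem_ball, Real.dist_eq, abs_of_nonneg (by linarith [hy.1])]
    linarith [hy.2]

theorem not_hasInterval_of_subset_singleton {S : Set ℝ} {c : ℝ} (h : S ⊆ {c}) :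
    ¬ HasInterval S := by
  rintro ⟨a, b, hab, hsub⟩
  have ha : a = c := h (hsub (left_mem_Icc.2 hab.le))
  have hb : b = c := h (hsub (right_mem_Icc.2 hab.le))
  linarith

theorem wordDom_nil {n : ℕ} (F : IntervalSystem n) : F.wordDom [] = univ := by
  ext x
  simp [wordDom, wordRel]

theorem wordDom_cons {n : ℕ} (F : IntervalSystem n) (i : Fin n) (w : List (Fin n)) :
    F.wordDom (i :: w) = {x | x ∈ F.dom i ∧ F.map i x ∈ F.wordDom w} := by
  ext x
  simp only [wordDom, List.map_cons, wordRel, letterRel, mem_ofPred_eq]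
  constructor
  · rintro ⟨y, z, ⟨hx, rfl⟩, hw⟩
    exact ⟨hx, y, hw⟩
  · rintro ⟨hx, y, hw⟩
    exact ⟨y, _, ⟨hx, rfl⟩, hw⟩

open Classical in
/-- The number of words of length `m` whose domain meets `[x, y]` in a nondegenerate interval,
that is, the number of laps of the `m`-th iterate on `[x, y]`. -/
noncomputable def lapCount (F : IntervalSystem 2) (m : ℕ) (x y : ℝ) : ℕ :=
  ∑ w : Fin m → Fin 2, if HasInterval (F.wordDom (List.ofFn w) ∩ Icc x y) then 1 else 0

open Classical in
/-- The laps of the `(m + 1)`-st iterate on `[x, y]` along words that start with the letter `i`. -/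
noncomputable def branchCount (F : IntervalSystem 2) (i : Fin 2) (m : ℕ) (x y : ℝ) : ℕ :=
  ∑ w : Fin m → Fin 2, if HasInterval (F.wordDom (i :: List.ofFn w) ∩ Icc x y) then 1 else 0

theorem lapCount_zero (F : IntervalSystem 2) (x y : ℝ) :
    F.lapCount 0 x y = if x < y then 1 else 0 := by
  have h : HasInterval (Icc x y) ↔ x < y := by
    refine ⟨?_, fun h => ⟨x, y, h, subset_rfl⟩⟩
    rintro ⟨a, b, hab, hsub⟩
    linarith [(hsub (left_mem_Icc.2 hab.le)).1, (hsub (right_mem_Icc.2 hab.le)).2]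
  simp [lapCount, wordDom_nil, h]

theorem lapCount_succ (F : IntervalSystem 2) (m : ℕ) (x y : ℝ) :
    F.lapCount (m + 1) x y = F.branchCount 0 m x y + F.branchCount 1 m x y := by
  classical
  unfold lapCount branchCount
  rw [← (Fin.consEquiv (fun _ : Fin (m + 1) => Fin 2)).sum_comp, Fintype.sum_prod_type,
    Fin.sum_univ_two]
  simp [Fin.consEquiv, List.ofFn_succ]

theorem lapCount_self (F : IntervalSystem 2) (m : ℕ) (x : ℝ) : F.lapCount m x x = 0 := by
  unfold lapCount
  refine Finset.sum_eq_zero fun w _ => if_neg (not_hasInterval_of_subset_singleton (c := x) ?_)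
  rw [Icc_self]
  exact inter_subset_right

theorem lapCount_mono (F : IntervalSystem 2) (m : ℕ) {x y x' y' : ℝ} (hx : x' ≤ x) (hy : y ≤ y') :
    F.lapCount m x y ≤ F.lapCount m x' y' := by
  classical
  unfold lapCount
  refine Finset.sum_le_sum fun w _ => ?_
  split_ifs with h h'
  · exact le_rfl
  · exact absurd (h.mono (inter_subset_inter_right _ (Icc_subset_Icc hx hy))) h'
  · exact Nat.zero_le _
  · exact le_rfl

/-- Two increasing branches with domains `[0, q]` and `[q, 1]` and values in `[0, 1]`. -/
structure IsLorenz (F : IntervalSystem 2) (q : ℝ) : Prop where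
  pos : 0 < q
  lt_one : q < 1
  dom_zero : F.dom 0 = Icc 0 q
  dom_one : F.dom 1 = Icc q 1
  strictMono : ∀ i, StrictMonoOn (F.map i) (F.dom i)
  mapsTo : ∀ i, MapsTo (F.map i) (F.dom i) (Icc 0 1)

namespace IsLorenz

variable {F : IntervalSystem 2} {q : ℝ}

theorem zero_mem (hF : F.IsLorenz q) : (0 : ℝ) ∈ F.dom 0 := by
  rw [hF.dom_zero]; exact ⟨le_rfl, hF.pos.le⟩

theorem q_mem (hF : F.IsLorenz q) (i : Fin 2) : q ∈ F.dom i := by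
  fin_cases i
  · exact hF.dom_zero ▸ right_mem_Icc.2 hF.pos.le
  · exact hF.dom_one ▸ left_mem_Icc.2 hF.lt_one.le

theorem one_mem (hF : F.IsLorenz q) : (1 : ℝ) ∈ F.dom 1 := by
  rw [hF.dom_one]; exact ⟨hF.lt_one.le, le_rfl⟩

theorem dom_subset (hF : F.IsLorenz q) (i : Fin 2) : F.dom i ⊆ Icc 0 1 := by
  fin_cases i
  · exact hF.dom_zero ▸ Icc_subset_Icc_right hF.lt_one.le
  · exact hF.dom_one ▸ Icc_subset_Icc_left hF.pos.le

/-- Between two points of a branch, the word `i w` has an interval in its domain exactly when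
`w` has one between the images, because the branch is an increasing homeomorphism. -/
theorem hasInterval_cons_iff (hF : F.IsLorenz q) {i : Fin 2} (w : List (Fin 2)) {x y : ℝ}
    (hx : x ∈ F.dom i) (hy : y ∈ F.dom i) :
    HasInterval (F.wordDom (i :: w) ∩ Icc x y) ↔
      HasInterval (F.wordDom w ∩ Icc (F.map i x) (F.map i y)) := by
  have hcont := F.continuousOn_map i
  have hmono := hF.strictMono i
  have hord : ∀ {a b}, a ∈ F.dom i → b ∈ F.dom i → Icc a b ⊆ F.dom i :=
    fun ha hb => Icc_subset_Icc ha.1 hb.2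
  rw [wordDom_cons]
  constructor
  · rintro ⟨a, b, hab, hsub⟩
    have ha := hsub (left_mem_Icc.2 hab.le)
    have hb := hsub (right_mem_Icc.2 hab.le)
    refine ⟨F.map i a, F.map i b, hmono ha.1.1 hb.1.1 hab, fun z hz => ?_⟩
    obtain ⟨c, hc, rfl⟩ :=
      intermediate_value_Icc hab.le (hcont.mono (hord ha.1.1 hb.1.1)) hz
    have hc' := hsub hc
    exact ⟨hc'.1.2, hmono.monotoneOn hx hc'.1.1 hc'.2.1, hmono.monotoneOn hc'.1.1 hy hc'.2.2⟩
  · rintro ⟨c, d, hcd, hsub⟩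
    have hc := hsub (left_mem_Icc.2 hcd.le)
    have hd := hsub (right_mem_Icc.2 hcd.le)
    have hxy : x ≤ y := (hmono.le_iff_le hx hy).1 (hc.2.1.trans hc.2.2)
    have hivt := intermediate_value_Icc hxy (hcont.mono (hord hx hy))
    obtain ⟨a, ha, rfl⟩ := hivt hc.2
    obtain ⟨b, hb, rfl⟩ := hivt hd.2
    have ha' := hord hx hy ha
    have hb' := hord hx hy hb
    refine ⟨a, b, (hmono.lt_iff_lt ha' hb').1 hcd, fun z hz => ?_⟩
    have hz' := hord ha' hb' hz
    exact ⟨⟨hz', (hsub ⟨hmono.monotoneOn ha' hz' hz.1, hmono.monotoneOn hz' hb' hz.2⟩).1⟩,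
      ha.1.trans hz.1, hz.2.trans hb.2⟩

theorem branchCount_eq (hF : F.IsLorenz q) {i : Fin 2} (m : ℕ) {x y : ℝ}
    (hx : x ∈ F.dom i) (hy : y ∈ F.dom i) :
    F.branchCount i m x y = F.lapCount m (F.map i x) (F.map i y) := by
  classical
  unfold branchCount lapCount
  simp only [hF.hasInterval_cons_iff _ hx hy]

theorem branchCount_zero_split (hF : F.IsLorenz q) (m : ℕ) {x y : ℝ} (hqy : q ≤ y) :
    F.branchCount 0 m x y = F.branchCount 0 m x q := by
  classical
  unfold branchCount
  have : ∀ w, F.wordDom (0 :: w) ∩ Icc x y = F.wordDom (0 :: w) ∩ Icc x q := by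
    intro w
    ext z
    simp only [wordDom_cons, hF.dom_zero, mem_inter_iff, mem_ofPred_eq, mem_Icc]
    constructor
    · rintro ⟨⟨hz, hw⟩, hxy⟩
      exact ⟨⟨hz, hw⟩, hxy.1, hz.2⟩
    · rintro ⟨⟨hz, hw⟩, hxy⟩
      exact ⟨⟨hz, hw⟩, hxy.1, hz.2.trans hqy⟩
  simp only [this]

theorem branchCount_one_split (hF : F.IsLorenz q) (m : ℕ) {x y : ℝ} (hxq : x ≤ q) :
    F.branchCount 1 m x y = F.branchCount 1 m q y := by
  classical
  unfold branchCount
  have : ∀ w, F.wordDom (1 :: w) ∩ Icc x y = F.wordDom (1 :: w) ∩ Icc q y := by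
    intro w
    ext z
    simp only [wordDom_cons, hF.dom_one, mem_inter_iff, mem_ofPred_eq, mem_Icc]
    constructor
    · rintro ⟨⟨hz, hw⟩, hxy⟩
      exact ⟨⟨hz, hw⟩, hz.1, hxy.2⟩
    · rintro ⟨⟨hz, hw⟩, hxy⟩
      exact ⟨⟨hz, hw⟩, hxq.trans hz.1, hxy.2⟩
  simp only [this]

theorem branchCount_one_left (hF : F.IsLorenz q) (m : ℕ) {x y : ℝ} (hyq : y ≤ q) :
    F.branchCount 1 m x y = 0 := by
  classical
  unfold branchCount
  refine Finset.sum_eq_zero fun w _ => if_neg (not_hasInterval_of_subset_singleton (c := q) ?_)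
  rintro z ⟨hz, hz'⟩
  rw [wordDom_cons, hF.dom_one] at hz
  exact le_antisymm (hz'.2.trans hyq) hz.1.1

theorem branchCount_zero_right (hF : F.IsLorenz q) (m : ℕ) {x y : ℝ} (hqx : q ≤ x) :
    F.branchCount 0 m x y = 0 := by
  classical
  unfold branchCount
  refine Finset.sum_eq_zero fun w _ => if_neg (not_hasInterval_of_subset_singleton (c := q) ?_)
  rintro z ⟨hz, hz'⟩
  rw [wordDom_cons, hF.dom_zero] at hz
  exact le_antisymm hz.1.2 (hqx.trans hz'.1)

/-- On a single branch, a lap of the `(m + 1)`-st iterate is a lap of the `m`-th iterate on the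
image. -/
theorem lapCount_succ_branch (hF : F.IsLorenz q) {i : Fin 2} (m : ℕ) {x y : ℝ}
    (hx : x ∈ F.dom i) (hy : y ∈ F.dom i) :
    F.lapCount (m + 1) x y = F.lapCount m (F.map i x) (F.map i y) := by
  rw [lapCount_succ, ← hF.branchCount_eq m hx hy]
  fin_cases i
  · have hy' := hy
    simp only [Fin.zero_eta, hF.dom_zero] at hy'
    simp [hF.branchCount_one_left m hy'.2]
  · have hx' := hx
    simp only [Fin.mk_one, hF.dom_one] at hx'
    simp [hF.branchCount_zero_right m hx'.1]

/-- The turning point `q` never lies inside a lap of a positive iterate. -/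
theorem lapCount_succ_split (hF : F.IsLorenz q) (m : ℕ) {x y : ℝ} (hxq : x ≤ q) (hqy : q ≤ y) :
    F.lapCount (m + 1) x y = F.lapCount (m + 1) x q + F.lapCount (m + 1) q y := by
  rw [lapCount_succ, lapCount_succ, lapCount_succ, hF.branchCount_zero_split m hqy,
    hF.branchCount_one_split m hxq, hF.branchCount_one_left m le_rfl,
    hF.branchCount_zero_right m le_rfl]
  ring

theorem mem_dom_zero (hF : F.IsLorenz q) {x : ℝ} (h0 : 0 ≤ x) (hq : x ≤ q) : x ∈ F.dom 0 := by
  rw [hF.dom_zero]; exact ⟨h0, hq⟩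

theorem mem_dom_one (hF : F.IsLorenz q) {x : ℝ} (hq : q ≤ x) (h1 : x ≤ 1) : x ∈ F.dom 1 := by
  rw [hF.dom_one]; exact ⟨hq, h1⟩

/-- A statement about an interval `[x, y] ⊆ [0, 1]` may be proved on the two branches and then
glued at `q`. -/
theorem interval_induction (hF : F.IsLorenz q) {P : ℝ → ℝ → Prop}
    (hbranch : ∀ i x y, x ∈ F.dom i → y ∈ F.dom i → x ≤ y → P x y)
    (hglue : ∀ x y, 0 ≤ x → x < q → q < y → y ≤ 1 → P x q → P q y → P x y)
    {x y : ℝ} (h0 : 0 ≤ x) (hxy : x ≤ y) (h1 : y ≤ 1) : P x y := by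
  rcases le_or_gt y q with hyq | hqy
  · exact hbranch 0 x y (hF.mem_dom_zero h0 (hxy.trans hyq))
      (hF.mem_dom_zero (h0.trans hxy) hyq) hxy
  rcases le_or_gt q x with hqx | hxq
  · exact hbranch 1 x y (hF.mem_dom_one hqx (hxy.trans h1))
      (hF.mem_dom_one hqy.le h1) hxy
  · exact hglue x y h0 hxq hqy h1
      (hbranch 0 x q (hF.mem_dom_zero h0 hxq.le) (hF.q_mem 0) hxq.le)
      (hbranch 1 q y (hF.q_mem 1) (hF.mem_dom_one hqy.le h1) hqy.le)

theorem map_nonneg (hF : F.IsLorenz q) {i : Fin 2} {x : ℝ} (hx : x ∈ F.dom i) :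
    0 ≤ F.map i x := (hF.mapsTo i hx).1

theorem map_le_one (hF : F.IsLorenz q) {i : Fin 2} {x : ℝ} (hx : x ∈ F.dom i) :
    F.map i x ≤ 1 := (hF.mapsTo i hx).2

theorem map_le_map (hF : F.IsLorenz q) {i : Fin 2} {x y : ℝ} (hx : x ∈ F.dom i)
    (hy : y ∈ F.dom i) (hxy : x ≤ y) : F.map i x ≤ F.map i y :=
  (hF.strictMono i).monotoneOn hx hy hxy

/-- Cutting an interval at `z` cuts at most one lap in two. -/
theorem lapCount_add (hF : F.IsLorenz q) (m : ℕ) : ∀ {x z y : ℝ}, 0 ≤ x → x ≤ z → z ≤ y → y ≤ 1 →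
    F.lapCount m x y ≤ F.lapCount m x z + F.lapCount m z y ∧
      F.lapCount m x z + F.lapCount m z y ≤ F.lapCount m x y + 1 := by
  induction m with
  | zero =>
    intro x z y _ hxz hzy _
    simp only [lapCount_zero]
    split_ifs <;> first | omega | (exfalso; linarith)
  | succ m ih =>
    intro x z y h0 hxz hzy h1
    have key : ∀ i x z y, x ∈ F.dom i → y ∈ F.dom i → x ≤ z → z ≤ y →
        F.lapCount (m + 1) x y ≤ F.lapCount (m + 1) x z + F.lapCount (m + 1) z y ∧
        F.lapCount (m + 1) x z + F.lapCount (m + 1) z y ≤ F.lapCount (m + 1) x y + 1 := by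
      intro i x z y hx hy hxz hzy
      have hz : z ∈ F.dom i := ⟨hx.1.trans hxz, hzy.trans hy.2⟩
      rw [hF.lapCount_succ_branch m hx hy, hF.lapCount_succ_branch m hx hz,
        hF.lapCount_succ_branch m hz hy]
      exact ih (hF.map_nonneg hx) (hF.map_le_map hx hz hxz) (hF.map_le_map hz hy hzy)
        (hF.map_le_one hy)
    have hz0 := h0.trans hxz
    have hz1 := hzy.trans h1
    rcases le_or_gt y q with hyq | hqy
    · exact key 0 x z y (hF.mem_dom_zero h0 (hxz.trans (hzy.trans hyq)))
        (hF.mem_dom_zero (hz0.trans hzy) hyq) hxz hzy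
    rcases le_or_gt q x with hqx | hxq
    · exact key 1 x z y (hF.mem_dom_one hqx (hxz.trans hz1)) (hF.mem_dom_one hqy.le h1) hxz hzy
    rw [hF.lapCount_succ_split m hxq.le hqy.le]
    rcases le_total z q with hzq | hqz
    · have := key 0 x z q (hF.mem_dom_zero h0 hxq.le) (hF.q_mem 0) hxz hzq
      rw [hF.lapCount_succ_split m hzq hqy.le]
      omega
    · have := key 1 q z y (hF.q_mem 1) (hF.mem_dom_one hqy.le h1) hqz hzy
      rw [hF.lapCount_succ_split m hxq.le hqz]
      omega

theorem lapCount_pos (hF : F.IsLorenz q) (m : ℕ) : ∀ {x y : ℝ}, 0 ≤ x → x < y → y ≤ 1 →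
    0 < F.lapCount m x y := by
  induction m with
  | zero => intro x y _ hxy _; simp [lapCount_zero, hxy]
  | succ m ih =>
    intro x y h0 hxy h1
    refine hF.interval_induction (P := fun x y => x < y → 0 < F.lapCount (m + 1) x y) ?_ ?_
      h0 hxy.le h1 hxy
    · intro i x y hx hy _ hlt
      rw [hF.lapCount_succ_branch m hx hy]
      exact ih (hF.map_nonneg hx) (hF.strictMono i hx hy hlt) (hF.map_le_one hy)
    · intro x y _ hxq hqy _ h _ _
      rw [hF.lapCount_succ_split m hxq.le hqy.le]
      have := h hxq
      omega

theorem lapCount_add_le_mul (hF : F.IsLorenz q) (m n : ℕ) : ∀ {x y : ℝ}, 0 ≤ x → x ≤ y → y ≤ 1 →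
    F.lapCount (m + n) x y ≤ F.lapCount m x y * F.lapCount n 0 1 := by
  induction m with
  | zero =>
    intro x y h0 hxy h1
    rw [zero_add, lapCount_zero]
    split_ifs with h
    · simpa using F.lapCount_mono n h0 h1
    · rw [le_antisymm hxy (not_lt.1 h), lapCount_self]; simp
  | succ m ih =>
    intro x y h0 hxy h1
    rw [Nat.add_right_comm]
    refine hF.interval_induction (P := fun x y => F.lapCount (m + n + 1) x y ≤
      F.lapCount (m + 1) x y * F.lapCount n 0 1) ?_ ?_ h0 hxy h1
    · intro i x y hx hy hxy
      rw [hF.lapCount_succ_branch _ hx hy, hF.lapCount_succ_branch _ hx hy]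
      exact ih (hF.map_nonneg hx) (hF.map_le_map hx hy hxy) (hF.map_le_one hy)
    · intro x y _ hxq hqy _ h h'
      rw [hF.lapCount_succ_split _ hxq.le hqy.le, hF.lapCount_succ_split _ hxq.le hqy.le, add_mul]
      exact add_le_add h h'

theorem wordDom_subset (hF : F.IsLorenz q) {w : List (Fin 2)} (hw : w ≠ []) :
    F.wordDom w ⊆ Icc 0 1 := by
  obtain ⟨i, v, rfl⟩ := List.exists_cons_of_ne_nil hw
  rw [wordDom_cons]
  exact fun x hx => hF.dom_subset i hx.1

theorem wordCount_eq (hF : F.IsLorenz q) (m : ℕ) : F.wordCount m = F.lapCount m 0 1 := by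
  classical
  have h : ∀ w : Fin m → Fin 2, (interior (F.wordDom (List.ofFn w))).Nonempty ↔
      HasInterval (F.wordDom (List.ofFn w) ∩ Icc 0 1) := by
    intro w
    rw [← hasInterval_iff_interior_nonempty]
    rcases m with _ | m
    · simp only [List.ofFn_zero, wordDom_nil, univ_inter]
      exact ⟨fun _ => ⟨0, 1, one_pos, subset_rfl⟩, fun h => h.mono (subset_univ _)⟩
    · rw [inter_eq_left.2 (hF.wordDom_subset (by simp [List.ofFn_succ]))]
  simp only [wordCount, h, Nat.card_eq_fintype_card, Fintype.card_subtype, lapCount,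
    Finset.card_filter]

/-! ### The growth number -/

theorem lapCount_zero_one_pos (hF : F.IsLorenz q) (m : ℕ) : 0 < F.lapCount m 0 1 :=
  hF.lapCount_pos m le_rfl one_pos le_rfl

/-- Fekete's lemma: the number of laps is submultiplicative, so that its growth rate is a limit and
a lower bound. -/
theorem tendsto_growthNumber (hF : F.IsLorenz q) :
    Tendsto (fun m : ℕ => (F.lapCount m 0 1 : ℝ) ^ (1 / (m : ℝ))) atTop (nhds F.growthNumber) ∧
      ∀ m, F.growthNumber ^ m ≤ F.lapCount m 0 1 := by
  have hpos : ∀ m, (0 : ℝ) < F.lapCount m 0 1 := fun m => by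
    exact_mod_cast hF.lapCount_zero_one_pos m
  set u : ℕ → ℝ := fun m => Real.log (F.lapCount m 0 1) with hu
  have hsub : Subadditive u := by
    intro m n
    rw [hu]
    simp only
    rw [← Real.log_mul (hpos m).ne' (hpos n).ne']
    refine Real.log_le_log (hpos _) ?_
    exact_mod_cast hF.lapCount_add_le_mul m n le_rfl zero_le_one le_rfl
  have hnonneg : ∀ m, 0 ≤ u m := fun m =>
    Real.log_nonneg (by exact_mod_cast hF.lapCount_zero_one_pos m)
  have hbdd : BddBelow (range fun n : ℕ => u n / n) :=
    ⟨0, by rintro _ ⟨n, rfl⟩; exact div_nonneg (hnonneg n) n.cast_nonneg⟩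
  have heq : ∀ m : ℕ, (F.lapCount m 0 1 : ℝ) ^ (1 / (m : ℝ)) = Real.exp (u m / m) := by
    intro m
    rw [Real.rpow_def_of_pos (hpos m), mul_one_div]
  have htend : Tendsto (fun m : ℕ => (F.lapCount m 0 1 : ℝ) ^ (1 / (m : ℝ))) atTop
      (nhds (Real.exp hsub.lim)) := by
    simp only [heq]
    exact (Real.continuous_exp.tendsto _).comp (hsub.tendsto_lim hbdd)
  have hs : F.growthNumber = Real.exp hsub.lim := by
    unfold growthNumber
    simp only [hF.wordCount_eq]
    exact htend.limsup_eq
  rw [hs]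
  refine ⟨htend, fun m => ?_⟩
  rcases eq_or_ne m 0 with rfl | hm
  · rw [pow_zero]
    exact_mod_cast hF.lapCount_zero_one_pos 0
  rw [← Real.exp_nat_mul, ← Real.le_log_iff_exp_le (hpos m)]
  have := hsub.lim_le_div hbdd hm
  rwa [le_div_iff₀ (by positivity), mul_comm] at this

theorem summable_lapCount (hF : F.IsLorenz q) {t : ℝ} (ht0 : 0 < t)
    (ht : t < F.growthNumber⁻¹) : Summable fun m => (F.lapCount m 0 1 : ℝ) * t ^ m := by
  have hs : 0 < F.growthNumber := inv_pos.1 (ht0.trans ht)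
  obtain ⟨r, hr, hr'⟩ := exists_between ((lt_inv_comm₀ ht0 hs).1 ht)
  have hr0 : 0 < r := hs.trans hr
  have hrt : r * t < 1 := (lt_div_iff₀ ht0).1 (by rwa [one_div])
  refine (summable_geometric_of_lt_one (by positivity) hrt).of_norm_bounded_eventually_nat ?_
  filter_upwards [hF.tendsto_growthNumber.1.eventually_lt_const hr, eventually_gt_atTop 0]
    with m hm hm0
  rw [Real.norm_of_nonneg (by positivity), mul_pow]
  gcongr
  have hm' : (m : ℝ) ≠ 0 := by positivity
  calc (F.lapCount m 0 1 : ℝ) = ((F.lapCount m 0 1 : ℝ) ^ (1 / (m : ℝ))) ^ m := by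
        rw [← Real.rpow_natCast, ← Real.rpow_mul (by positivity), one_div_mul_cancel hm',
          Real.rpow_one]
    _ ≤ r ^ m := by gcongr

end IsLorenz

open Topology

/-! ### Conformal distribution functions -/

/-- A measure on `[0, 1]` of total mass one whose mass on intervals is multiplied by `s` under each
branch, given by its distribution function `φ`. Only the values of `φ` on `[0, 1]` matter. -/
structure IsConformal (F : IntervalSystem 2) (s : ℝ) (φ : ℝ → ℝ) : Prop where
  map_zero : φ 0 = 0
  map_one : φ 1 = 1
  monotoneOn : MonotoneOn φ (Icc 0 1)
  map_sub : ∀ i, ∀ x ∈ F.dom i, ∀ y ∈ F.dom i, x ≤ y →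
    φ (F.map i y) - φ (F.map i x) = s * (φ y - φ x)

theorem IsConformal.mem_Icc {F : IntervalSystem 2} {s : ℝ} {φ : ℝ → ℝ} (hφ : IsConformal F s φ)
    {x : ℝ} (hx : x ∈ Icc (0 : ℝ) 1) : φ x ∈ Icc (0 : ℝ) 1 :=
  ⟨hφ.map_zero ▸ hφ.monotoneOn ⟨le_rfl, zero_le_one⟩ hx hx.1,
    hφ.map_one ▸ hφ.monotoneOn hx ⟨zero_le_one, le_rfl⟩ hx.2⟩

/-- The constant term of the `i`-th branch of the affine model of slope `s` determined by `φ`; it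
does not depend on the point of the branch used to compute it, and `q` lies on both branches. -/
noncomputable def affineConst (F : IntervalSystem 2) (q s : ℝ) (φ : ℝ → ℝ) (i : Fin 2) : ℝ :=
  φ (F.map i q) - s * φ q

/-! ### The limit of normalized lap series -/

/-- The generating function `∑ ℓ_m(x, y) t ^ m` of the numbers of laps on `[x, y]`. -/
noncomputable def lapSeries (F : IntervalSystem 2) (t x y : ℝ) : ℝ :=
  ∑' m : ℕ, (F.lapCount m x y : ℝ) * t ^ m

theorem lapSeries_self (F : IntervalSystem 2) (t x : ℝ) : F.lapSeries t x x = 0 := by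
  simp [lapSeries, lapCount_self]

theorem lapSeries_nonneg (F : IntervalSystem 2) {t : ℝ} (ht : 0 ≤ t) (x y : ℝ) :
    0 ≤ F.lapSeries t x y :=
  tsum_nonneg fun m => by positivity

namespace IsLorenz

variable {F : IntervalSystem 2} {q : ℝ}

theorem summable_lapSeries (hF : F.IsLorenz q) {t : ℝ} (ht0 : 0 < t)
    (ht : t < F.growthNumber⁻¹) {x y : ℝ} (hx : 0 ≤ x) (hy : y ≤ 1) :
    Summable fun m => (F.lapCount m x y : ℝ) * t ^ m := by
  refine (hF.summable_lapCount ht0 ht).of_nonneg_of_le (fun m => by positivity) fun m => ?_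
  have := F.lapCount_mono m hx hy
  gcongr

theorem lapSeries_mono (hF : F.IsLorenz q) {t : ℝ} (ht0 : 0 < t)
    (ht : t < F.growthNumber⁻¹) {x y x' y' : ℝ} (h0 : 0 ≤ x') (hx : x' ≤ x) (hy : y ≤ y')
    (h1 : y' ≤ 1) : F.lapSeries t x y ≤ F.lapSeries t x' y' := by
  refine (hF.summable_lapSeries ht0 ht (h0.trans hx) (hy.trans h1)).tsum_le_tsum (fun m => ?_)
    (hF.summable_lapSeries ht0 ht h0 h1)
  have := F.lapCount_mono m hx hy
  gcongr

theorem lapSeries_branch (hF : F.IsLorenz q) {t : ℝ} (ht0 : 0 < t)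
    (ht : t < F.growthNumber⁻¹) {i : Fin 2} {x y : ℝ} (hx : x ∈ F.dom i) (hy : y ∈ F.dom i)
    (hxy : x < y) :
    F.lapSeries t x y = 1 + t * F.lapSeries t (F.map i x) (F.map i y) := by
  unfold lapSeries
  rw [(hF.summable_lapSeries ht0 ht (hF.dom_subset i hx).1 (hF.dom_subset i hy).2).tsum_eq_zero_add,
    ← tsum_mul_left]
  simp only [hF.lapCount_succ_branch _ hx hy, lapCount_zero, hxy, if_true, Nat.cast_one, pow_zero,
    mul_one]
  congr 1
  exact tsum_congr fun m => by ring

theorem abs_lapSeries_add_sub_le (hF : F.IsLorenz q) {t : ℝ} (ht0 : 0 < t) (ht1 : t < 1)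
    (ht : t < F.growthNumber⁻¹) {x y : ℝ} (h0 : 0 ≤ x) (hxy : x ≤ y) (h1 : y ≤ 1) :
    |F.lapSeries t 0 x + F.lapSeries t x y - F.lapSeries t 0 y| ≤ (1 - t)⁻¹ := by
  have s1 := hF.summable_lapSeries ht0 ht le_rfl (hxy.trans h1)
  have s2 := hF.summable_lapSeries ht0 ht h0 h1
  have s3 := hF.summable_lapSeries ht0 ht le_rfl h1
  unfold lapSeries
  rw [← s1.tsum_add s2, ← (s1.add s2).tsum_sub s3, ← Real.norm_eq_abs]
  refine tsum_of_norm_bounded (hasSum_geometric_of_lt_one ht0.le ht1) fun m => ?_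
  obtain ⟨h, h'⟩ := hF.lapCount_add m le_rfl h0 hxy h1
  have h : (F.lapCount m 0 y : ℝ) ≤ F.lapCount m 0 x + F.lapCount m x y := by exact_mod_cast h
  have h' : (F.lapCount m 0 x : ℝ) + F.lapCount m x y ≤ F.lapCount m 0 y + 1 := by exact_mod_cast h'
  rw [← add_mul, ← sub_mul, Real.norm_of_nonneg (by
    have := pow_pos ht0 m
    exact mul_nonneg (by linarith) this.le)]
  have := pow_pos ht0 m
  nlinarith

theorem inv_one_sub_le_lapSeries (hF : F.IsLorenz q) {t : ℝ} (ht0 : 0 < t)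
    (ht : t < F.growthNumber⁻¹) :
    (1 - F.growthNumber * t)⁻¹ ≤ F.lapSeries t 0 1 := by
  have hs : 0 < F.growthNumber := inv_pos.1 (ht0.trans ht)
  have hst : F.growthNumber * t < 1 := by
    rwa [← lt_inv_mul_iff₀ hs, mul_one]
  rw [← tsum_geometric_of_lt_one (by positivity) hst]
  refine (summable_geometric_of_lt_one (by positivity) hst).tsum_le_tsum (fun m => ?_)
    (hF.summable_lapCount ht0 ht)
  rw [mul_pow]
  have := hF.tendsto_growthNumber.2 m
  gcongr

theorem tendsto_lapSeries (hF : F.IsLorenz q) (hs : 1 < F.growthNumber) :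
    Tendsto (fun t => F.lapSeries t 0 1) (𝓝[<] F.growthNumber⁻¹) atTop := by
  have hs0 : 0 < F.growthNumber := one_pos.trans hs
  have h : Tendsto (fun t => 1 - F.growthNumber * t) (𝓝[<] F.growthNumber⁻¹) (𝓝[>] 0) := by
    refine tendsto_nhdsWithin_iff.2 ⟨?_, ?_⟩
    · have : ContinuousAt (fun t => 1 - F.growthNumber * t) F.growthNumber⁻¹ := by fun_prop
      have h := this.tendsto
      rw [mul_inv_cancel₀ hs0.ne', sub_self] at h
      exact h.mono_left nhdsWithin_le_nhds
    · filter_upwards [self_mem_nhdsWithin] with t ht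
      rw [mem_Iio, ← mul_one F.growthNumber⁻¹, lt_inv_mul_iff₀ hs0] at ht
      exact sub_pos.2 ht
  refine tendsto_atTop_mono' _ ?_ (tendsto_inv_nhdsGT_zero.comp h)
  filter_upwards [Ioo_mem_nhdsLT (inv_pos.2 hs0)] with t ht
  exact hF.inv_one_sub_le_lapSeries ht.1 ht.2

/-- The normalized lap series `∑ ℓ_m(0, x) t ^ m / ∑ ℓ_m(0, 1) t ^ m` accumulate at a conformal
distribution function as `t` increases to `1 / s`, where the denominator diverges. -/
theorem exists_isConformal (hF : F.IsLorenz q) (hs : 1 < F.growthNumber) :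
    ∃ φ, IsConformal F F.growthNumber φ := by
  set s := F.growthNumber
  have hs0 : 0 < s := one_pos.trans hs
  -- An ultrafilter replaces the passage to convergent subsequences.
  let u : Ultrafilter ℝ := Ultrafilter.of (𝓝[<] s⁻¹)
  have hu : (u : Filter ℝ) ≤ 𝓝[<] s⁻¹ := Ultrafilter.of_le _
  have hmem : ∀ᶠ t in (u : Filter ℝ), t ∈ Ioo 0 s⁻¹ := hu (Ioo_mem_nhdsLT (inv_pos.2 hs0))
  have hdiv : Tendsto (fun t => F.lapSeries t 0 1) u atTop := (hF.tendsto_lapSeries hs).mono_left hu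
  have hid : Tendsto (fun t : ℝ => t) u (𝓝 s⁻¹) := hu.trans nhdsWithin_le_nhds
  have hpos : ∀ᶠ t in (u : Filter ℝ), 0 < F.lapSeries t 0 1 := hdiv.eventually_gt_atTop 0
  have hlim : ∀ x, ∃ l, x ∈ Icc (0 : ℝ) 1 →
      Tendsto (fun t => F.lapSeries t 0 x / F.lapSeries t 0 1) u (𝓝 l) := by
    intro x
    by_cases hx : x ∈ Icc (0 : ℝ) 1
    · have hc := isCompact_iff_ultrafilter_le_nhds.1 (isCompact_Icc (a := (0 : ℝ)) (b := 1))
        (u.map fun t => F.lapSeries t 0 x / F.lapSeries t 0 1) ?_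
      · obtain ⟨l, _, hl⟩ := hc
        exact ⟨l, fun _ => hl⟩
      · rw [le_principal_iff]
        change ∀ᶠ t in (u : Filter ℝ), _
        filter_upwards [hmem, hpos] with t ht hp
        exact ⟨div_nonneg (F.lapSeries_nonneg ht.1.le _ _) hp.le,
          (div_le_one hp).2 (hF.lapSeries_mono ht.1 ht.2 le_rfl le_rfl hx.2 le_rfl)⟩
    · exact ⟨0, fun h => absurd h hx⟩
  choose φ hφ using hlim
  have hinv : Tendsto (fun t => (F.lapSeries t 0 1)⁻¹) u (𝓝 0) := hdiv.inv_tendsto_atTop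
  have hsub : ∀ {x y : ℝ}, 0 ≤ x → x ≤ y → y ≤ 1 →
      Tendsto (fun t => F.lapSeries t x y / F.lapSeries t 0 1) u (𝓝 (φ y - φ x)) := by
    intro x y h0 hxy h1
    have herr : Tendsto (fun t => (F.lapSeries t 0 x + F.lapSeries t x y - F.lapSeries t 0 y) /
        F.lapSeries t 0 1) u (𝓝 0) := by
      have hb : Tendsto (fun t : ℝ => (1 - t)⁻¹ * (F.lapSeries t 0 1)⁻¹) u (𝓝 0) := by
        have : Tendsto (fun t : ℝ => (1 - t)⁻¹) u (𝓝 (1 - s⁻¹)⁻¹) :=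
          (hid.const_sub 1).inv₀ (sub_pos.2 (inv_lt_one_of_one_lt₀ hs)).ne'
        simpa using this.mul hinv
      refine squeeze_zero_norm' ?_ hb
      filter_upwards [hmem, hpos] with t ht hp
      rw [norm_div, Real.norm_eq_abs, Real.norm_of_nonneg hp.le, div_eq_mul_inv]
      have := hF.abs_lapSeries_add_sub_le ht.1 (ht.2.trans (inv_lt_one_of_one_lt₀ hs)) ht.2 h0 hxy h1
      gcongr
    have := ((hφ y ⟨h0.trans hxy, h1⟩).sub (hφ x ⟨h0, hxy.trans h1⟩)).add herr
    rw [add_zero] at this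
    refine this.congr fun t => ?_
    ring
  refine ⟨φ, ?_, ?_, ?_, ?_⟩
  · refine tendsto_nhds_unique (hφ 0 ⟨le_rfl, zero_le_one⟩) ?_
    simp [lapSeries_self]
  · refine tendsto_nhds_unique (hφ 1 ⟨zero_le_one, le_rfl⟩) (tendsto_const_nhds.congr' ?_)
    filter_upwards [hpos] with t hp
    exact (div_self hp.ne').symm
  · intro x hx y hy hxy
    refine sub_nonneg.1 (ge_of_tendsto (hsub hx.1 hxy hy.2) ?_)
    filter_upwards [hmem, hpos] with t ht hp
    exact div_nonneg (F.lapSeries_nonneg ht.1.le _ _) hp.le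
  · intro i x hx y hy hxy
    rcases hxy.eq_or_lt with rfl | hlt
    · simp
    have h1 := hsub (hF.dom_subset i hx).1 hxy (hF.dom_subset i hy).2
    have h2 := hinv.add (hid.mul
      (hsub (hF.map_nonneg hx) (hF.map_le_map hx hy hxy) (hF.map_le_one hy)))
    have h3 := tendsto_nhds_unique h1 (h2.congr' ?_)
    · rw [h3]
      field_simp
      ring
    · filter_upwards [hmem] with t ht
      rw [hF.lapSeries_branch ht.1 ht.2 hx hy hlt]
      ring

/-! ### Continuity and nondegeneracy of conformal distribution functions -/

variable {s : ℝ} {φ : ℝ → ℝ}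

theorem conformal_pos (hF : F.IsLorenz q) (hs : 1 < s) (hφ : IsConformal F s φ) : 0 < φ q := by
  have h := hφ.map_sub 1 q (hF.q_mem 1) 1 hF.one_mem hF.lt_one.le
  have h1 := hφ.mem_Icc (hF.mapsTo 1 hF.one_mem)
  have h2 := hφ.mem_Icc (hF.mapsTo 1 (hF.q_mem 1))
  have h3 := hφ.mem_Icc (hF.dom_subset 1 (hF.q_mem 1))
  rw [hφ.map_one] at h
  refine h3.1.lt_of_ne fun h0 => ?_
  rw [← h0] at h
  linarith [h1.2, h2.1]

theorem conformal_lt_one (hF : F.IsLorenz q) (hs : 1 < s) (hφ : IsConformal F s φ) :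
    φ q < 1 := by
  have h := hφ.map_sub 0 0 hF.zero_mem q (hF.q_mem 0) hF.pos.le
  have h1 := hφ.mem_Icc (hF.mapsTo 0 hF.zero_mem)
  have h2 := hφ.mem_Icc (hF.mapsTo 0 (hF.q_mem 0))
  have h3 := hφ.mem_Icc (hF.dom_subset 1 (hF.q_mem 1))
  rw [hφ.map_zero] at h
  refine h3.2.lt_of_ne fun h0 => ?_
  rw [h0] at h
  linarith [h1.1, h2.2]

/-- A jump of `φ` to the left of `x` of size at least `ε` would be multiplied by `s` at each step
along the orbit of `x`, while the total mass is one. -/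
theorem exists_sub_lt_left (hF : F.IsLorenz q) (hs : 1 < s) (hφ : IsConformal F s φ) {x ε : ℝ}
    (hx0 : 0 < x) (hx1 : x ≤ 1) (hε : 0 < ε) : ∃ y, 0 ≤ y ∧ y < x ∧ φ x - φ y < ε := by
  by_contra! hbad
  have hall : ∀ n : ℕ, ∃ x : ℝ, 0 < x ∧ x ≤ 1 ∧ ∀ y, 0 ≤ y → y < x → s ^ n * ε ≤ φ x - φ y := by
    intro n
    induction n with
    | zero => exact ⟨x, hx0, hx1, by simpa using hbad⟩
    | succ n ih =>
      obtain ⟨x, hx0, hx1, hx⟩ := ih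
      obtain ⟨i, l, hl, hl0, hxi, hlx⟩ : ∃ i l, l ∈ F.dom i ∧ 0 ≤ l ∧ x ∈ F.dom i ∧ l < x := by
        rcases le_or_gt x q with h | h
        · exact ⟨0, 0, hF.zero_mem, le_rfl, hF.mem_dom_zero hx0.le h, hx0⟩
        · exact ⟨1, q, hF.q_mem 1, hF.pos.le, hF.mem_dom_one h.le hx1, h⟩
      have hfl := hF.strictMono i hl hxi hlx
      refine ⟨F.map i x, (hF.map_nonneg hl).trans_lt hfl, hF.map_le_one hxi, fun y hy0 hy => ?_⟩
      obtain ⟨z, hz, hzy⟩ := intermediate_value_Icc hlx.le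
        ((F.continuousOn_map i).mono (Icc_subset_Icc hl.1 hxi.2))
        (show max y (F.map i l) ∈ _ from ⟨le_max_right _ _, max_le hy.le hfl.le⟩)
      have hzi : z ∈ F.dom i := ⟨hl.1.trans hz.1, hz.2.trans hxi.2⟩
      have hzx : z < x := (hF.strictMono i).lt_iff_lt hzi hxi |>.1 (hzy ▸ max_lt hy hfl)
      have h1 := hφ.map_sub i z hzi x hxi hzx.le
      have h2 : φ y ≤ φ (F.map i z) := hφ.monotoneOn ⟨hy0, hy.le.trans (hF.map_le_one hxi)⟩
        (hF.mapsTo i hzi) (hzy ▸ le_max_left _ _)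
      have h3 := mul_le_mul_of_nonneg_left (hx z (hl0.trans hz.1) hzx) (one_pos.trans hs).le
      rw [pow_succ']
      linarith
  obtain ⟨n, hn⟩ := pow_unbounded_of_one_lt ε⁻¹ hs
  obtain ⟨x, hx0, hx1, hx⟩ := hall n
  have h1 := hx 0 le_rfl hx0
  have h2 := (hφ.mem_Icc ⟨hx0.le, hx1⟩).2
  have h3 : 1 < s ^ n * ε := by rwa [← div_lt_iff₀ hε, one_div]
  rw [hφ.map_zero] at h1
  linarith

theorem exists_sub_lt_right (hF : F.IsLorenz q) (hs : 1 < s) (hφ : IsConformal F s φ) {x ε : ℝ}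
    (hx0 : 0 ≤ x) (hx1 : x < 1) (hε : 0 < ε) : ∃ y, x < y ∧ y ≤ 1 ∧ φ y - φ x < ε := by
  by_contra! hbad
  have hall : ∀ n : ℕ, ∃ x : ℝ, 0 ≤ x ∧ x < 1 ∧ ∀ y, x < y → y ≤ 1 → s ^ n * ε ≤ φ y - φ x := by
    intro n
    induction n with
    | zero => exact ⟨x, hx0, hx1, by simpa using hbad⟩
    | succ n ih =>
      obtain ⟨x, hx0, hx1, hx⟩ := ih
      obtain ⟨i, r, hr, hr1, hxi, hxr⟩ : ∃ i r, r ∈ F.dom i ∧ r ≤ 1 ∧ x ∈ F.dom i ∧ x < r := by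
        rcases lt_or_ge x q with h | h
        · exact ⟨0, q, hF.q_mem 0, hF.lt_one.le, hF.mem_dom_zero hx0 h.le, h⟩
        · exact ⟨1, 1, hF.one_mem, le_rfl, hF.mem_dom_one h hx1.le, hx1⟩
      have hfr := hF.strictMono i hxi hr hxr
      refine ⟨F.map i x, hF.map_nonneg hxi, hfr.trans_le (hF.map_le_one hr), fun y hy hy1 => ?_⟩
      obtain ⟨z, hz, hzy⟩ := intermediate_value_Icc hxr.le
        ((F.continuousOn_map i).mono (Icc_subset_Icc hxi.1 hr.2))
        (show min y (F.map i r) ∈ _ from ⟨le_min hy.le hfr.le, min_le_right _ _⟩)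
      have hzi : z ∈ F.dom i := ⟨hxi.1.trans hz.1, hz.2.trans hr.2⟩
      have hxz : x < z := (hF.strictMono i).lt_iff_lt hxi hzi |>.1 (hzy ▸ lt_min hy hfr)
      have h1 := hφ.map_sub i x hxi z hzi hxz.le
      have h2 : φ (F.map i z) ≤ φ y := hφ.monotoneOn (hF.mapsTo i hzi)
        ⟨(hF.map_nonneg hxi).trans hy.le, hy1⟩ (hzy ▸ min_le_left _ _)
      have h3 := mul_le_mul_of_nonneg_left (hx z hxz (hz.2.trans hr1)) (one_pos.trans hs).le
      rw [pow_succ']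
      linarith
  obtain ⟨n, hn⟩ := pow_unbounded_of_one_lt ε⁻¹ hs
  obtain ⟨x, hx0, hx1, hx⟩ := hall n
  have h1 := hx 1 hx1 le_rfl
  have h2 := (hφ.mem_Icc ⟨hx0, hx1.le⟩).1
  have h3 : 1 < s ^ n * ε := by rwa [← div_lt_iff₀ hε, one_div]
  rw [hφ.map_one] at h1
  linarith

theorem conformal_continuousOn (hF : F.IsLorenz q) (hs : 1 < s) (hφ : IsConformal F s φ) :
    ContinuousOn φ (Icc 0 1) := by
  intro x hx
  refine tendsto_order.2 ⟨fun a ha => ?_, fun b hb => ?_⟩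
  · rcases hx.1.eq_or_lt with rfl | hx0
    · filter_upwards [self_mem_nhdsWithin] with z hz
      exact ha.trans_le (hφ.monotoneOn hx hz hz.1)
    · obtain ⟨y, hy0, hyx, hy⟩ := exists_sub_lt_left hF hs hφ hx0 hx.2 (sub_pos.2 ha)
      filter_upwards [self_mem_nhdsWithin,
        mem_nhdsWithin_of_mem_nhds (Ioi_mem_nhds hyx)] with z hz hz'
      have := hφ.monotoneOn ⟨hy0, hyx.le.trans hx.2⟩ hz (le_of_lt hz')
      linarith
  · rcases hx.2.eq_or_lt with rfl | hx1
    · filter_upwards [self_mem_nhdsWithin] with z hz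
      exact (hφ.monotoneOn hz hx hz.2).trans_lt hb
    · obtain ⟨y, hxy, hy1, hy⟩ := exists_sub_lt_right hF hs hφ hx.1 hx1 (sub_pos.2 hb)
      filter_upwards [self_mem_nhdsWithin,
        mem_nhdsWithin_of_mem_nhds (Iio_mem_nhds hxy)] with z hz hz'
      have := hφ.monotoneOn hz ⟨hx.1.trans hxy.le, hy1⟩ (le_of_lt hz')
      linarith

end IsLorenz

/-! ### Itinerary series -/

/-- The power series of the itinerary of an arbitrary point `x` under the symbol rule `sym`. -/
noncomputable def itinerarySeries (F : IntervalSystem 2) (sym : ℝ → Fin 2) (t x : ℝ) : ℝ :=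
  symbolSeries (fun k => sym (F.symOrbit sym x k)) t

/-- The symbol rule that regards `q` as a point of the left branch. -/
noncomputable def leftSymbol (q x : ℝ) : Fin 2 := if x ≤ q then 0 else 1

/-- The symbol rule that regards `q` as a point of the right branch. -/
noncomputable def rightSymbol (q x : ℝ) : Fin 2 := if x < q then 0 else 1

theorem symbolSeries_leftItinerary (F : IntervalSystem 2) (q t : ℝ) :
    symbolSeries (F.leftItinerary q) t = F.itinerarySeries (leftSymbol q) t q := rfl

theorem symbolSeries_rightItinerary (F : IntervalSystem 2) (q t : ℝ) :
    symbolSeries (F.rightItinerary q) t = F.itinerarySeries (rightSymbol q) t q := rfl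

theorem symOrbit_succ' (F : IntervalSystem 2) (sym : ℝ → Fin 2) (x : ℝ) (k : ℕ) :
    F.symOrbit sym x (k + 1) = F.symOrbit sym (F.map (sym x) x) k := by
  induction k with
  | zero => rfl
  | succ k ih => rw [symOrbit, ih, symOrbit]

theorem symbol_mem (i : Fin 2) : ((i : ℕ) : ℝ) ∈ Icc (0 : ℝ) 1 :=
  ⟨Nat.cast_nonneg _, by exact_mod_cast Nat.lt_succ_iff.1 i.isLt⟩

theorem summable_symbolSeries (a : ℕ → Fin 2) {t : ℝ} (ht0 : 0 ≤ t) (ht1 : t < 1) :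
    Summable fun i => ((a i : ℕ) : ℝ) * t ^ i :=
  (summable_geometric_of_lt_one ht0 ht1).of_nonneg_of_le
    (fun i => mul_nonneg (symbol_mem _).1 (by positivity))
    fun i => mul_le_of_le_one_left (by positivity) (symbol_mem _).2

theorem symbolSeries_mem (a : ℕ → Fin 2) {t : ℝ} (ht0 : 0 ≤ t) (ht1 : t < 1) :
    symbolSeries a t ∈ Icc 0 (1 - t)⁻¹ := by
  refine ⟨tsum_nonneg fun i => mul_nonneg (symbol_mem _).1 (by positivity), ?_⟩
  rw [← tsum_geometric_of_lt_one ht0 ht1]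
  exact (summable_symbolSeries a ht0 ht1).tsum_le_tsum
    (fun i => mul_le_of_le_one_left (by positivity) (symbol_mem _).2)
    (summable_geometric_of_lt_one ht0 ht1)

theorem itinerarySeries_eq (F : IntervalSystem 2) (sym : ℝ → Fin 2) {t : ℝ} (ht0 : 0 ≤ t)
    (ht1 : t < 1) (x : ℝ) :
    F.itinerarySeries sym t x =
      ((sym x : ℕ) : ℝ) + t * F.itinerarySeries sym t (F.map (sym x) x) := by
  unfold itinerarySeries symbolSeries
  rw [(summable_symbolSeries (fun k => sym (F.symOrbit sym x k)) ht0 ht1).tsum_eq_zero_add,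
    ← tsum_mul_left, pow_zero, mul_one]
  congr 1
  refine tsum_congr fun k => ?_
  rw [symOrbit_succ', pow_succ']
  ring

namespace IsLorenz

variable {F : IntervalSystem 2} {q s : ℝ} {φ : ℝ → ℝ}

theorem mem_dom_leftSymbol (hF : F.IsLorenz q) {x : ℝ} (hx : x ∈ Icc (0 : ℝ) 1) :
    x ∈ F.dom (leftSymbol q x) := by
  unfold leftSymbol
  split_ifs with h
  · exact hF.mem_dom_zero hx.1 h
  · exact hF.mem_dom_one (not_le.1 h).le hx.2

theorem mem_dom_rightSymbol (hF : F.IsLorenz q) {x : ℝ} (hx : x ∈ Icc (0 : ℝ) 1) :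
    x ∈ F.dom (rightSymbol q x) := by
  unfold rightSymbol
  split_ifs with h
  · exact hF.mem_dom_zero hx.1 h.le
  · exact hF.mem_dom_one (not_lt.1 h) hx.2

theorem symbol_eq_of_lt (hF : F.IsLorenz q) {i : Fin 2} {x y : ℝ} (hx : x ∈ F.dom i)
    (hy : y ∈ F.dom i) (hxy : x < y) : rightSymbol q x = i ∧ leftSymbol q y = i := by
  unfold rightSymbol leftSymbol
  fin_cases i
  · simp only [Fin.zero_eta, hF.dom_zero] at hx hy ⊢
    exact ⟨if_pos (hxy.trans_le hy.2), if_pos hy.2⟩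
  · simp only [Fin.mk_one, hF.dom_one] at hx hy ⊢
    exact ⟨if_neg (not_lt.2 hx.1), if_neg (not_le.2 (hx.1.trans_lt hxy))⟩

/-! ### Minimality of the inverse growth number -/

/-- If the two critical series agree at `t`, the itinerary series at `t` vary by at most
`(1 - t)⁻¹ t ^ m` over each lap of the `m`-th iterate, and do not jump between laps. -/
theorem abs_itinerarySeries_sub_le (hF : F.IsLorenz q) {t : ℝ} (ht0 : 0 < t) (ht1 : t < 1)
    (heq : F.itinerarySeries (leftSymbol q) t q = F.itinerarySeries (rightSymbol q) t q) (m : ℕ) :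
    ∀ {x y : ℝ}, 0 ≤ x → x < y → y ≤ 1 →
      |F.itinerarySeries (rightSymbol q) t x - F.itinerarySeries (leftSymbol q) t y| ≤
        F.lapCount m x y * t ^ m * (1 - t)⁻¹ := by
  induction m with
  | zero =>
    intro x y _ hxy _
    have h1 := symbolSeries_mem (fun k => rightSymbol q (F.symOrbit (rightSymbol q) x k)) ht0.le ht1
    have h2 := symbolSeries_mem (fun k => leftSymbol q (F.symOrbit (leftSymbol q) y k)) ht0.le ht1
    simp only [lapCount_zero, hxy, if_true, Nat.cast_one, pow_zero, one_mul]
    exact abs_sub_le_iff.2 ⟨(sub_le_self _ h2.1).trans h1.2, (sub_le_self _ h1.1).trans h2.2⟩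
  | succ m ih =>
    intro x y h0 hxy h1
    refine hF.interval_induction (P := fun x y => x < y →
      |F.itinerarySeries (rightSymbol q) t x - F.itinerarySeries (leftSymbol q) t y| ≤
        F.lapCount (m + 1) x y * t ^ (m + 1) * (1 - t)⁻¹) ?_ ?_ h0 hxy.le h1 hxy
    · intro i x y hx hy _ hlt
      obtain ⟨hi, hi'⟩ := hF.symbol_eq_of_lt hx hy hlt
      have := ih (hF.map_nonneg hx) (hF.strictMono i hx hy hlt) (hF.map_le_one hy)
      rw [itinerarySeries_eq F _ ht0.le ht1 x, itinerarySeries_eq F _ ht0.le ht1 y, hi, hi',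
        add_sub_add_left_eq_sub, ← mul_sub, abs_mul, abs_of_pos ht0, hF.lapCount_succ_branch m hx hy,
        pow_succ]
      calc _ ≤ t * _ := mul_le_mul_of_nonneg_left this ht0.le
        _ = _ := by ring
    · intro x y _ hxq hqy _ h h' _
      rw [hF.lapCount_succ_split m hxq.le hqy.le]
      have h := h hxq
      have h' := h' hqy
      rw [heq] at h
      push_cast
      rw [add_mul, add_mul]
      refine (abs_sub_le _ (F.itinerarySeries (rightSymbol q) t q) _).trans (add_le_add h h')

/-- Below `1 / s` the number of laps grows more slowly than `t ^ (-m)`. Equal critical series would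
make all itinerary series equal to one constant `c`, with `c = t c` and `c = 1 + t c`. -/
theorem inv_growthNumber_le (hF : F.IsLorenz q) {t : ℝ} (ht0 : 0 < t) (ht1 : t < 1)
    (heq : F.itinerarySeries (leftSymbol q) t q = F.itinerarySeries (rightSymbol q) t q) :
    F.growthNumber⁻¹ ≤ t := by
  by_contra! ht
  have hconst : ∀ {x y : ℝ}, 0 ≤ x → x < y → y ≤ 1 →
      F.itinerarySeries (rightSymbol q) t x = F.itinerarySeries (leftSymbol q) t y := by
    intro x y h0 hxy h1
    have hlim := ((hF.summable_lapSeries ht0 ht h0 h1).tendsto_atTop_zero).mul_const (1 - t)⁻¹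
    rw [zero_mul] at hlim
    have := ge_of_tendsto' hlim fun m => hF.abs_itinerarySeries_sub_le ht0 ht1 heq m h0 hxy h1
    exact sub_eq_zero.1 (abs_nonpos_iff.1 this)
  have hL := itinerarySeries_eq F (leftSymbol q) ht0.le ht1 q
  have hR := itinerarySeries_eq F (rightSymbol q) ht0.le ht1 q
  simp only [leftSymbol, rightSymbol, le_refl, lt_irrefl, if_true, if_false] at hL hR
  change F.itinerarySeries (leftSymbol q) t q =
    _ + t * F.itinerarySeries (leftSymbol q) t (F.map 0 q) at hL
  change F.itinerarySeries (rightSymbol q) t q =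
    _ + t * F.itinerarySeries (rightSymbol q) t (F.map 1 q) at hR
  have h0 := (hF.map_nonneg hF.zero_mem).trans_lt
    (hF.strictMono 0 hF.zero_mem (hF.q_mem 0) hF.pos)
  have h1 := (hF.strictMono 1 (hF.q_mem 1) hF.one_mem hF.lt_one).trans_le
    (hF.map_le_one hF.one_mem)
  rw [← hconst le_rfl h0 (hF.map_le_one (hF.q_mem 0)),
    hconst le_rfl hF.pos hF.lt_one.le] at hL
  rw [hconst (hF.map_nonneg (hF.q_mem 1)) h1 le_rfl, ← hconst hF.pos.le hF.lt_one le_rfl,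
    ← heq] at hR
  simp only [Fin.val_zero, Fin.val_one, Nat.cast_zero, Nat.cast_one] at hL hR
  linarith

/-! ### The affine model -/

theorem conformal_map (hF : F.IsLorenz q) (hφ : IsConformal F s φ) {i : Fin 2} {x : ℝ}
    (hx : x ∈ F.dom i) : φ (F.map i x) = s * φ x + affineConst F q s φ i := by
  unfold affineConst
  rcases le_total x q with h | h
  · linarith [hφ.map_sub i x hx q (hF.q_mem i) h]
  · linarith [hφ.map_sub i q (hF.q_mem i) x hx h]

theorem affineConst_ne (hF : F.IsLorenz q) (hs : 1 < s) (hφ : IsConformal F s φ) :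
    affineConst F q s φ 0 ≠ affineConst F q s φ 1 := by
  intro h
  have h0 := conformal_map hF hφ hF.zero_mem
  have h1 := conformal_map hF hφ hF.one_mem
  rw [hφ.map_zero] at h0
  rw [hφ.map_one] at h1
  have := (hφ.mem_Icc (hF.mapsTo 0 hF.zero_mem)).1
  have := (hφ.mem_Icc (hF.mapsTo 1 hF.one_mem)).2
  linarith

/-- The position of a point in the affine model is an affine function of its itinerary series at
`1 / s`: the difference of the two sides is bounded, and multiplied by `s` along the orbit. -/
theorem conformal_eq_itinerarySeries (hF : F.IsLorenz q) (hs : 1 < s) (hφ : IsConformal F s φ)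
    {sym : ℝ → Fin 2} (hsym : ∀ x ∈ Icc (0 : ℝ) 1, x ∈ F.dom (sym x)) {x : ℝ}
    (hx : x ∈ Icc (0 : ℝ) 1) :
    φ x = -(affineConst F q s φ 0 / (s - 1)) -
      (affineConst F q s φ 1 - affineConst F q s φ 0) / s * F.itinerarySeries sym s⁻¹ x := by
  have hs0 : 0 < s := one_pos.trans hs
  have hs1 : s - 1 ≠ 0 := (sub_pos.2 hs).ne'
  set c := affineConst F q s φ with hc
  set D : ℝ → ℝ := fun x => φ x + c 0 / (s - 1) + (c 1 - c 0) / s * F.itinerarySeries sym s⁻¹ x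
    with hD
  have hstep : ∀ x ∈ Icc (0 : ℝ) 1, D (F.map (sym x) x) = s * D x := by
    intro x hx
    have h1 := conformal_map hF hφ (hsym x hx)
    have h2 := itinerarySeries_eq F sym (inv_nonneg.2 hs0.le) (inv_lt_one_of_one_lt₀ hs) x
    have hci : c (sym x) = c 0 + ((sym x : ℕ) : ℝ) * (c 1 - c 0) := by
      generalize sym x = i
      fin_cases i <;> simp
    rw [← hc, hci] at h1
    simp only [hD, h1]
    rw [h2]
    field_simp
    ring
  obtain ⟨B, hB⟩ : ∃ B, ∀ x ∈ Icc (0 : ℝ) 1, |D x| ≤ B := by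
    refine ⟨1 + |c 0 / (s - 1)| + |(c 1 - c 0) / s| * (1 - s⁻¹)⁻¹, fun x hx => ?_⟩
    have h1 := hφ.mem_Icc hx
    have h2 := symbolSeries_mem (fun k => sym (F.symOrbit sym x k)) (inv_nonneg.2 hs0.le)
      (inv_lt_one_of_one_lt₀ hs)
    refine (abs_add_le _ _).trans (add_le_add ((abs_add_le _ _).trans (add_le_add ?_ le_rfl)) ?_)
    · rw [abs_of_nonneg h1.1]; exact h1.2
    · rw [abs_mul]
      exact mul_le_mul_of_nonneg_left ((abs_of_nonneg h2.1).trans_le h2.2) (abs_nonneg _)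
  have hpow : ∀ n : ℕ, ∀ x ∈ Icc (0 : ℝ) 1, s ^ n * |D x| ≤ B := by
    intro n
    induction n with
    | zero => simpa using hB
    | succ n ih =>
      intro x hx
      have := ih _ (hF.mapsTo _ (hsym x hx))
      rwa [hstep x hx, abs_mul, abs_of_pos hs0, ← mul_assoc, ← pow_succ] at this
  have hzero : D x = 0 := by
    by_contra hne
    have hpos := abs_pos.2 hne
    obtain ⟨n, hn⟩ := pow_unbounded_of_one_lt (B / |D x|) hs
    exact absurd (hpow n x hx) (not_le.2 ((div_lt_iff₀ hpos).1 hn))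
  simp only [hD] at hzero
  linarith

theorem itinerarySeries_inv_eq (hF : F.IsLorenz q) (hs : 1 < s) (hφ : IsConformal F s φ) :
    F.itinerarySeries (leftSymbol q) s⁻¹ q = F.itinerarySeries (rightSymbol q) s⁻¹ q := by
  have hq : q ∈ Icc (0 : ℝ) 1 := ⟨hF.pos.le, hF.lt_one.le⟩
  have h1 := hF.conformal_eq_itinerarySeries hs hφ (fun _ => hF.mem_dom_leftSymbol) hq
  have h2 := hF.conformal_eq_itinerarySeries hs hφ (fun _ => hF.mem_dom_rightSymbol) hq
  rw [h1] at h2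
  exact mul_left_cancel₀ (div_ne_zero (sub_ne_zero.2 (hF.affineConst_ne hs hφ).symm)
    (one_pos.trans hs).ne') (by linarith)

end IsLorenz

/-- The system of two affine functions `x ↦ s x + c i` on `[0, p]` and `[p, 1]`. -/
noncomputable def affineSystem (p s : ℝ) (c : Fin 2 → ℝ) (hp0 : 0 ≤ p) (hp1 : p ≤ 1)
    (hs : 0 < s) : IntervalSystem 2 where
  left := ![0, p]
  right := ![p, 1]
  left_le_right i := by fin_cases i <;> simpa
  map i x := s * x + c i
  continuousOn_map i := by fun_prop
  strict_map i := Or.inl fun x _ y _ hxy => by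
    have := mul_lt_mul_of_pos_left hxy hs
    simpa using this

theorem isInvariant_of_mapsTo {n : ℕ} {F : IntervalSystem n} {K : Set ℝ}
    (hdom : ∀ i, F.dom i ⊆ K) (hmap : ∀ i, MapsTo (F.map i) (F.dom i) K) : F.IsInvariant K := by
  intro g
  induction g.toWord with
  | nil =>
    intro x hx y h
    exact (show x = y from h) ▸ hx
  | cons a w ih =>
    rintro x hx y ⟨z, hz, hw⟩
    refine ih z ?_ y hw
    obtain ⟨i, b⟩ := a
    cases b with
    | false => exact hdom i hz.1
    | true => exact hz.2 ▸ hmap i hz.1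

end IntervalSystem

open IntervalSystem in
theorem mainTheorem6 (F : IntervalSystem 2) (q : ℝ) (hq0 : 0 < q) (hq1 : q < 1)
    (hdom0 : F.dom 0 = Set.Icc 0 q) (hdom1 : F.dom 1 = Set.Icc q 1)
    (h00 : 0 ≤ F.map 0 0) (h0 : F.map 0 0 < F.map 0 q) (h0q : F.map 0 q ≤ 1)
    (h1q : 0 ≤ F.map 1 q) (h1 : F.map 1 q < F.map 1 1) (h11 : F.map 1 1 ≤ 1)
    (hentropy : 0 < F.entropy) :
    IsLeast {t : ℝ | t ∈ Set.Ioo (0 : ℝ) 1 ∧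
        IntervalSystem.symbolSeries (F.leftItinerary q) t =
          IntervalSystem.symbolSeries (F.rightItinerary q) t}
      (F.growthNumber)⁻¹ ∧
    ∃ (U : IntervalSystem 2) (p : ℝ) (φ : ℝ → ℝ),
      0 < p ∧ p < 1 ∧ U.dom 0 = Set.Icc 0 p ∧ U.dom 1 = Set.Icc p 1 ∧
      U.IsAffineWithSlope F.growthNumber ∧
      F.IsSemiconjugacy (Set.Icc 0 1) U (Set.Icc 0 1) id φ ∧
      (F.map 0 0 = 0 → F.map 1 1 = 1 →
        (∀ x ∈ Set.Icc 0 p, U.map 0 x = F.growthNumber * x) ∧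
        (∀ x ∈ Set.Icc p 1, U.map 1 x = F.growthNumber * (x - 1) + 1) ∧
        p = (1 - (F.growthNumber)⁻¹) *
          IntervalSystem.symbolSeries (F.leftItinerary q) (F.growthNumber)⁻¹) := by
  have hs : 1 < F.growthNumber := by
    rwa [entropy, ENNReal.zero_lt_log_iff, ENNReal.one_lt_ofReal] at hentropy
  have hm0 : StrictMonoOn (F.map 0) (Set.Icc 0 q) := by
    rcases F.strict_map 0 with h | h
    · exact hdom0 ▸ h
    · have h : StrictAntiOn (F.map 0) (Set.Icc 0 q) := hdom0 ▸ h
      exact absurd (h ⟨le_rfl, hq0.le⟩ ⟨hq0.le, le_rfl⟩ hq0) h0.not_gt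
  have hm1 : StrictMonoOn (F.map 1) (Set.Icc q 1) := by
    rcases F.strict_map 1 with h | h
    · exact hdom1 ▸ h
    · have h : StrictAntiOn (F.map 1) (Set.Icc q 1) := hdom1 ▸ h
      exact absurd (h ⟨le_rfl, hq1.le⟩ ⟨hq1.le, le_rfl⟩ hq1) h1.not_gt
  have hF : F.IsLorenz q := by
    refine ⟨hq0, hq1, hdom0, hdom1, fun i => ?_, fun i x hx => ?_⟩
    · fin_cases i
      · exact hdom0 ▸ hm0
      · exact hdom1 ▸ hm1
    · fin_cases i
      · have hx : x ∈ Set.Icc 0 q := hdom0 ▸ hx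
        exact ⟨h00.trans (hm0.monotoneOn ⟨le_rfl, hq0.le⟩ hx hx.1),
          (hm0.monotoneOn hx ⟨hq0.le, le_rfl⟩ hx.2).trans h0q⟩
      · have hx : x ∈ Set.Icc q 1 := hdom1 ▸ hx
        exact ⟨h1q.trans (hm1.monotoneOn ⟨le_rfl, hq1.le⟩ hx hx.1),
          (hm1.monotoneOn hx ⟨hq1.le, le_rfl⟩ hx.2).trans h11⟩
  obtain ⟨φ, hφ⟩ := hF.exists_isConformal hs
  have hs0 : 0 < F.growthNumber := one_pos.trans hs
  refine ⟨⟨⟨⟨inv_pos.2 hs0, inv_lt_one_of_one_lt₀ hs⟩, hF.itinerarySeries_inv_eq hs hφ⟩,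
    fun t ht => hF.inv_growthNumber_le ht.1.1 ht.1.2 ht.2⟩, ?_⟩
  set s := F.growthNumber
  set c := affineConst F q s φ with hc
  have hp0 := hF.conformal_pos hs hφ
  have hp1 := hF.conformal_lt_one hs hφ
  have hqI : q ∈ Set.Icc (0 : ℝ) 1 := ⟨hq0.le, hq1.le⟩
  have hcont := hF.conformal_continuousOn hs hφ
  set U := affineSystem (φ q) s c hp0.le hp1.le hs0 with hU
  have hU0 : U.dom 0 = Set.Icc 0 (φ q) := rfl
  have hU1 : U.dom 1 = Set.Icc (φ q) 1 := rfl
  have hUmap : ∀ i x, U.map i x = s * x + c i := fun _ _ => rfl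
  have hUdom : ∀ i, U.dom i ⊆ Set.Icc 0 1 := by
    intro i
    fin_cases i
    · exact Set.Icc_subset_Icc_right hp1.le
    · exact Set.Icc_subset_Icc_left hp0.le
  -- The images of the end points under the affine maps are values of `φ`.
  have hUmem : ∀ i, Set.MapsTo (U.map i) (U.dom i) (Set.Icc 0 1) := by
    have key : ∀ i a b, a ∈ F.dom i → b ∈ F.dom i → ∀ x ∈ Set.Icc (φ a) (φ b),
        U.map i x ∈ Set.Icc (0 : ℝ) 1 := by
      intro i a b ha hb x hx
      have h1 := hF.conformal_map hφ ha
      have h2 := hF.conformal_map hφ hb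
      have h3 := (hφ.mem_Icc (hF.mapsTo i ha)).1
      have h4 := (hφ.mem_Icc (hF.mapsTo i hb)).2
      have h5 := mul_le_mul_of_nonneg_left hx.1 hs0.le
      have h6 := mul_le_mul_of_nonneg_left hx.2 hs0.le
      rw [hUmap]
      constructor <;> linarith
    intro i x hx
    fin_cases i
    · exact key 0 0 q hF.zero_mem (hF.q_mem 0) x (by rw [hφ.map_zero]; exact hx)
    · exact key 1 q 1 (hF.q_mem 1) hF.one_mem x (by rw [hφ.map_one]; exact hx)
  refine ⟨U, φ q, φ, hp0, hp1, hU0, hU1, fun i => ⟨c i, fun x _ => hUmap i x⟩, ?_, ?_⟩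
  · refine ⟨isInvariant_of_mapsTo hF.dom_subset hF.mapsTo, isInvariant_of_mapsTo hUdom hUmem,
      hφ.monotoneOn, hcont, ?_, ?_, fun i x hx => hF.conformal_map hφ hx.2⟩
    · refine Set.Subset.antisymm ?_ ?_
      · rintro _ ⟨x, hx, rfl⟩
        exact hφ.mem_Icc hx
      · have := intermediate_value_Icc (zero_le_one (α := ℝ)) hcont
        rwa [hφ.map_zero, hφ.map_one] at this
    · rintro i x ⟨hx, hxi⟩
      have hmem := hφ.mem_Icc hx
      refine ⟨hmem, ?_⟩
      fin_cases i
      · have hxi : x ∈ Set.Icc 0 q := hdom0 ▸ hxi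
        exact ⟨hmem.1, hφ.monotoneOn hx hqI hxi.2⟩
      · have hxi : x ∈ Set.Icc q 1 := hdom1 ▸ hxi
        exact ⟨hφ.monotoneOn hqI hx hxi.1, hmem.2⟩
  · intro hf0 hf1
    have hc0 : c 0 = 0 := by
      have := hF.conformal_map hφ hF.zero_mem
      rw [hf0, hφ.map_zero] at this
      linarith
    have hc1 : c 1 = 1 - s := by
      have := hF.conformal_map hφ hF.one_mem
      rw [hf1, hφ.map_one] at this
      linarith
    refine ⟨fun x _ => by rw [hUmap, hc0, add_zero], fun x _ => by rw [hUmap, hc1]; ring, ?_⟩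
    have := hF.conformal_eq_itinerarySeries hs hφ (fun _ => hF.mem_dom_leftSymbol) hqI
    rw [← hc, hc0, hc1] at this
    rw [this, symbolSeries_leftItinerary]
    field_simp
    ring
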